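/- **Setting of the search.** Let $Q$ be a topological space of controller parameters, $\Theta\subseteq Q$ the set of admissible parameters and $J:Q\to\mathbb R$ the total reward of an episode run with given parameters. Write $\mathrm{Opt}(\Theta)=\{\theta\in\Theta: J(\theta')\le J(\theta)\ \forall\theta'\in\Theta\}$ for the set of optimal parameters. Given candidates $\theta_0,\theta_1,\dots\in\Theta$, the control-based RL approach holds the parameters $\theta^*_0=\theta_0$, and $\theta^*_{e+1}=\theta_{e+1}$ if $J(\theta_{e+1})>J(\theta^*_e)$, $\theta^*_{e+1}=\theta^*_e$ otherwise. The candidates search all of $\Theta$ in one of two senses: * (D) $\{\theta_e\}$ is dense in $\Theta$; or * (R) the candidates are random (on any probability space), adapted to a filtration $(\mathcal F_e)$ and almost surely in $\Theta$, and for every open $U$ with $U\cap\Theta\neq\emptyset$, almost surely $\sum_e \mathbb P(\theta_{e+1}\in U\mid\mathcal F_e)=\infty$. **Theorem (convergence of the control-based RL approach).** **(1) Optimal controllers for the total reward.** Let $X$ be a separable metrizable state space with its Borel $\sigma$-algebra (for instance, a countable discrete space), with actions in $\mathbb R^k$, a transition kernel $\mathbb P(\cdot\mid x,a)$ that is weakly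 continuous in $(x,a)$, a bounded continuous reward $r(x,a,x')$, a discount factor $\gamma\in[0,1)$, an initial distribution $\rho$, and a continuous output map $K:X\to\mathbb R^d$. Let $X$ be partitioned into $M$ measurable regions whose boundaries are null for $\rho$ and for every $\mathbb P(\cdot\mid x,a)$ (automatic if $X$ is discrete or $M=1$). The policy with parameters $\theta=(\theta_1,\dots,\theta_M)$ is $a_\theta(x)=\kappa_{\theta_m}(K(x))$ for $x$ in region $m$. Here the control law $\kappa$ is linear, $\kappa_{(B,b)}(y)=By+b$; or nonlinear, $\kappa_{(B,C,D,b)}(y)=By+C\,y^{T}Dy+b$; or, more generally, any family of control laws that is jointly continuous in $y$ and in a parameter from a metrizable space. Let $$J(\theta)=\mathbb E\Big[\sum_{t\ge0}\gamma^t\, r(x_t,a_t,x_{t+1})\Big],\qquad x_0\sim\rho,\quad a_t=a_\theta(x_t),\quad x_{t+1}\sim\mathbb P(\cdot\mid x_t,a_t).$$ Let $\Theta$ be any set of parameters, and assume that optimal parameters exist: $\mathrm{Opt}(\Theta)\ne\emptyset$. Then, for every search of type (D), and almost surely for every search of type (R): * $J(\theta^*_e)\to\max_\Theta J$; * every accumulation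 point of $(\theta^*_e)$ in $\Theta$ belongs to $\mathrm{Opt}(\Theta)$; * if $\{\theta\in\Theta:J(\theta)\ge c\}$ is compact for some $c<\max_\Theta J$ (for instance, if $\Theta$ is compact), then $(\theta^*_e)$ converges to the set $\mathrm{Opt}(\Theta)$: every open set that contains $\mathrm{Opt}(\Theta)$ contains $\theta^*_e$ for all large $e$. **(2) Stabilizing feedback matrices.** Consider a system $\dot x=f(x,t)+u$ with $f$ continuous in $t$ and $f(x_0,t)=0$ for all $t$, or a system $x_{j+1}=f(x_j,j)+u_j$ with $f(x_0,j)=x_0$ for all $j$, in $\mathbb R^n$, where $f$ is Lipschitz in $x$ with a constant $L$ that does not depend on time. Call a matrix $B\in\mathbb R^{n\times n}$ stabilizing if, under the feedback $u=B(x-x_0)$, the equilibrium $x_0$ is locally exponentially stable, uniformly in the starting time ($t_0\ge0$, respectively $j_0\ge 0$). Let $\Theta\subseteq\mathbb R^{n\times n}$ contain a stabilizing matrix, and let $J:\mathbb R^{n\times n}\to\mathbb R$ be any total reward whose maximizers over $\Theta$ are exactly the stabilizing matrices in $\Theta$. Then, for every search of type (D), and almost surely for every search of type (R), $\theta^*_e$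 is an optimal, stabilizing feedback matrix for all sufficiently large $e$. -/

import Mathlib

open MeasureTheory ProbabilityTheory Filter Topology Set

noncomputable section

/-! ### Controllers -/

/-- A parametric form of control law, assigning to a parameter and a measurement `y ∈ ℝᵈ` a control
action in `ℝᵏ`, jointly continuously in the parameter and the measurement. -/
structure ControlModel (d k : ℕ) where
  /-- the parameters to be learnt -/
  Param : Type
  [topology : TopologicalSpace Param]
  [metrizable : TopologicalSpace.MetrizableSpace Param]
  /-- the control law -/
  law : Param → (Fin d → ℝ) → (Fin k → ℝ)
  continuous_law : Continuous fun q : Param × (Fin d → ℝ) => law q.1 q.2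

attribute [instance] ControlModel.topology ControlModel.metrizable

instance matrixMetrizable (m n : ℕ) : TopologicalSpace.MetrizableSpace (Matrix (Fin m) (Fin n) ℝ) :=
  inferInstanceAs (TopologicalSpace.MetrizableSpace (Fin m → Fin n → ℝ))

/-- The linear controller `a(y) = B y + b`, with parameters `(B, b)`. -/
def ControlModel.linear (d k : ℕ) : ControlModel d k where
  Param := Matrix (Fin k) (Fin d) ℝ × (Fin k → ℝ)
  law θ y := θ.1.mulVec y + θ.2
  continuous_law := by fun_prop

/-- The simple nonlinear controller `a(y) = B y + C yᵀ D y + b`, with parameters `(B, C, D, b)`. -/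
def ControlModel.quadratic (d k : ℕ) : ControlModel d k where
  Param := Matrix (Fin k) (Fin d) ℝ × Matrix (Fin k) (Fin 1) ℝ × Matrix (Fin d) (Fin d) ℝ ×
    (Fin k → ℝ)
  law θ y := θ.1.mulVec y + θ.2.1.mulVec (fun _ => y ⬝ᵥ θ.2.2.1.mulVec y) + θ.2.2.2
  continuous_law := by fun_prop

/-! ### The decision process and the objective -/

/-- A discounted Markov decision process with states `X` and actions `ℝᵏ`, together with a
measurement map into `ℝᵈ` and a partition of the state space into `M` regions. -/
structure ControlProblem (X : Type*) [MeasurableSpace X] (d k M : ℕ) where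
  /-- transition kernel `ℙ(· | x, a)` -/
  trans : Kernel (X × (Fin k → ℝ)) X
  [isMarkovKernel : IsMarkovKernel trans]
  /-- distribution of the initial state of an episode -/
  init : Measure X
  [isProbabilityMeasure : IsProbabilityMeasure init]
  /-- reward `r(xₜ, aₜ, xₜ₊₁)` -/
  reward : X → (Fin k → ℝ) → X → ℝ
  /-- discount factor -/
  γ : ℝ
  /-- the output process `y = K(x)` -/
  output : X → (Fin d → ℝ)
  measurable_output : Measurable output
  /-- index of the region containing a state -/
  region : X → Fin M
  measurable_region : Measurable region

attribute [instance] ControlProblem.isMarkovKernel ControlProblem.isProbabilityMeasure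

namespace ControlProblem

variable {X : Type*} [MeasurableSpace X] {d k M : ℕ}

/-- The standing regularity assumptions. On a countable discrete state space they say only that
`γ ∈ [0, 1)`, that rewards are bounded, and that rewards and transition probabilities depend
continuously on the action. -/
structure IsRegular [TopologicalSpace X] (S : ControlProblem X d k M) : Prop where
  γ_nonneg : 0 ≤ S.γ
  γ_lt_one : S.γ < 1
  bounded_reward : ∃ C : ℝ, ∀ x a x', |S.reward x a x'| ≤ C
  continuous_reward : Continuous fun q : X × (Fin k → ℝ) × X => S.reward q.1 q.2.1 q.2.2
  /-- transition probabilities are weakly continuous in state and action -/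
  continuous_trans : ∀ g : BoundedContinuousFunction X ℝ,
    Continuous fun q : X × (Fin k → ℝ) => ∫ x', g x' ∂(S.trans q)
  continuous_output : Continuous S.output
  /-- the boundaries of the regions are never hit (vacuous if `M = 1` or if `X` is discrete) -/
  init_frontier : ∀ m, S.init (frontier (S.region ⁻¹' {m})) = 0
  trans_frontier : ∀ q m, S.trans q (frontier (S.region ⁻¹' {m})) = 0

variable (S : ControlProblem X d k M) (κ : ControlModel d k)

/-- The piecewise control policy: in region `m` the control law with parameters `θ m` is used. -/
def policy (θ : Fin M → κ.Param) (x : X) : Fin k → ℝ :=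
  κ.law (θ (S.region x)) (S.output x)

theorem measurable_policy (θ : Fin M → κ.Param) : Measurable (S.policy κ θ) := by
  have h : ∀ m, Measurable fun x => κ.law (θ m) (S.output x) := fun m =>
    (κ.continuous_law.comp (Continuous.prodMk_right (θ m))).measurable.comp S.measurable_output
  have h2 : Measurable fun q : X × Fin M => κ.law (θ q.2) (S.output q.1) :=
    measurable_from_prod_countable_left h
  exact h2.comp (measurable_id.prodMk S.measurable_region)

/-- Transition kernel of the Markov chain of states under the policy with parameters `θ`. -/
def closedLoop (θ : Fin M → κ.Param) : Kernel X X :=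
  S.trans.comap (fun x => (x, S.policy κ θ x)) (measurable_id.prodMk (S.measurable_policy κ θ))

instance (θ : Fin M → κ.Param) : IsMarkovKernel (S.closedLoop κ θ) :=
  inferInstanceAs (IsMarkovKernel (S.trans.comap _ _))

/-- Law of the state trajectory `(x₀, x₁, …)` under the policy with parameters `θ`: `x₀` has law
`init`, and given the past the next state has law `ℙ(· | xₜ, aₜ)` with `aₜ = policy θ xₜ`. -/
def episodeLaw (θ : Fin M → κ.Param) : Measure (ℕ → X) :=
  Kernel.trajMeasure (X := fun _ => X) S.init fun t =>
    (S.closedLoop κ θ).comap (fun h : (Finset.Iic t → X) => h ⟨t, Finset.mem_Iic.2 le_rfl⟩)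
      (measurable_pi_apply _)

/-- Expected total discounted reward `𝔼[∑ₜ γᵗ r(xₜ, aₜ, xₜ₊₁)]` of an episode. -/
def totalReward (θ : Fin M → κ.Param) : ℝ :=
  ∫ x : ℕ → X, ∑' t : ℕ, S.γ ^ t * S.reward (x t) (S.policy κ θ (x t)) (x (t + 1))
    ∂(S.episodeLaw κ θ)

end ControlProblem

/-! ### The search -/

section Search

variable {Q : Type*}

/-- The parameters `θ*` held by the learning approach after episode `e`, when the candidate tried
in episode `e` is `θ e`: start from `θ 0`, and replace the current parameters exactly when an
episode improves the total reward `J`. -/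
def incumbent (J : Q → ℝ) (θ : ℕ → Q) : ℕ → Q
  | 0 => θ 0
  | e + 1 => if J (incumbent J θ e) < J (θ (e + 1)) then θ (e + 1) else incumbent J θ e

/-- The parameters in the admissible set `Θ` that maximize the total reward `J` over `Θ`. -/
def optimalSet (J : Q → ℝ) (Θ : Set Q) : Set Q :=
  {θ | θ ∈ Θ ∧ ∀ θ' ∈ Θ, J θ' ≤ J θ}

variable [TopologicalSpace Q]

/-- A sequence of candidates in `Θ` that searches all of `Θ`: the candidates are dense in `Θ`. -/
def IsDenseSearch (Θ : Set Q) (θ : ℕ → Q) : Prop :=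
  (∀ e, θ e ∈ Θ) ∧ Θ ⊆ closure (range θ)

/-- A randomized search of `Θ`. Candidate `e` may depend in any way on the history `ℱ e`, and no
part of `Θ` is neglected: for every open `U` meeting `Θ`, the conditional probabilities, given the
past, that the next candidate falls into `U` have infinite sum. -/
structure IsExploringSearch {Ω : Type*} {m : MeasurableSpace Ω} (μ : Measure Ω)
    (ℱ : Filtration ℕ m) (Θ : Set Q) (θ : ℕ → Ω → Q) : Prop where
  adapted : ∀ e, ∀ U, IsOpen U → MeasurableSet[ℱ e] (θ e ⁻¹' U)
  mem : ∀ᵐ ω ∂μ, ∀ e, θ e ω ∈ Θ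
  explores : ∀ U, IsOpen U → (U ∩ Θ).Nonempty → ∀ᵐ ω ∂μ,
    Tendsto (fun N : ℕ => ∑ e ∈ Finset.range N,
      (μ[(θ (e + 1) ⁻¹' U).indicator (1 : Ω → ℝ) | ℱ e]) ω) atTop atTop

/-- Asymptotic convergence of the parameters `s` to the set of optimal parameters. -/
structure ConvergesToOptimal (J : Q → ℝ) (Θ : Set Q) (s : ℕ → Q) : Prop where
  /-- the total rewards converge to the optimal total reward -/
  tendsto_reward : ∀ θ ∈ optimalSet J Θ, Tendsto (fun e => J (s e)) atTop (𝓝 (J θ))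
  /-- every accumulation point in `Θ` is optimal -/
  optimal_of_clusterPt : ∀ θ ∈ Θ, MapClusterPt θ atTop s → θ ∈ optimalSet J Θ
  /-- if some superlevel set of `J` below the optimal value is compact (for instance, if `Θ` is
  compact), then `s` eventually stays in every neighbourhood of the set of optimal parameters -/
  tendsto_optimalSet : (∃ c : ℝ, (∃ θ ∈ optimalSet J Θ, c < J θ) ∧ IsCompact {θ ∈ Θ | c ≤ J θ}) →
    Tendsto s atTop (𝓝ˢ (optimalSet J Θ))

end Search

/-! ### Stabilizing feedback matrices -/

section Stabilization

variable {n : ℕ}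

/-- The feedback `u = B (x - x₀)` stabilizes `ẋ = f(x, t) + u` at `x₀`: solutions of the closed
loop starting near `x₀` converge to `x₀`, uniformly exponentially. -/
def IsStabilizingContinuous (f : EuclideanSpace ℝ (Fin n) → ℝ → EuclideanSpace ℝ (Fin n))
    (x₀ : EuclideanSpace ℝ (Fin n)) (B : Matrix (Fin n) (Fin n) ℝ) : Prop :=
  ∃ c > 0, ∃ rate > 0, ∃ δ > 0, ∀ t₀ T : ℝ, 0 ≤ t₀ → ∀ x : ℝ → EuclideanSpace ℝ (Fin n),
    (∀ t ∈ Icc t₀ T, HasDerivWithinAt x (f (x t) t + Matrix.toEuclideanLin B (x t - x₀))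
      (Icc t₀ T) t) →
    ‖x t₀ - x₀‖ < δ →
    ∀ t ∈ Icc t₀ T, ‖x t - x₀‖ ≤ c * Real.exp (-rate * (t - t₀)) * ‖x t₀ - x₀‖

/-- The feedback `u = B (x - x₀)` stabilizes `x_{j+1} = f(x_j, j) + u_j` at `x₀`: trajectories of
the closed loop starting near `x₀` converge to `x₀`, uniformly exponentially. -/
def IsStabilizingDiscrete (f : EuclideanSpace ℝ (Fin n) → ℕ → EuclideanSpace ℝ (Fin n))
    (x₀ : EuclideanSpace ℝ (Fin n)) (B : Matrix (Fin n) (Fin n) ℝ) : Prop :=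
  ∃ c > 0, ∃ q > 0, q < 1 ∧ ∃ δ > 0, ∀ j₀ : ℕ, ∀ x : ℕ → EuclideanSpace ℝ (Fin n),
    (∀ j ≥ j₀, x (j + 1) = f (x j) j + Matrix.toEuclideanLin B (x j - x₀)) →
    ‖x j₀ - x₀‖ < δ →
    ∀ i : ℕ, ‖x (j₀ + i) - x₀‖ ≤ c * q ^ i * ‖x j₀ - x₀‖

end Stabilization

end

/-! ### Convergence of the incumbents -/

section SearchConvergence

variable {Q : Type*} {J : Q → ℝ} {Θ : Set Q}

/-! The reward of the incumbent is monotone and dominates that of every candidate tried so far. A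
search that meets every open set meeting `Θ` therefore drives it to the maximum once `J` is
continuous: try the open superlevel sets just below the maximum. Density gives such visits directly,
and the conditional Borel–Cantelli lemma gives them almost surely. Optimality of accumulation points
and convergence to the optimal set follow by continuity and compactness
(`convergesToOptimal_of_tendsto`).

For part (1) the substance is thus `continuous_totalReward`. By induction on time, the law of the
state depends weakly continuously on the parameters. The integrands vary with the parameters too,
and the policy may jump at region boundaries; since these are null,
`tendsto_integral_of_tendsto_of_continuously` still passes to the limit. Discounting makes the sum
over time uniformly convergent.

For part (2), `J` may be discontinuous, but it suffices that the stabilizing matrices form an open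
set: one candidate falling into it fixes optimality forever. Openness is robustness of exponential
stability (the two `exists_robust` theorems). Over a long enough window the nominal system contracts
by 1/4, a small perturbation adds an error of at most 1/4, and the resulting factor 1/2 is iterated
window by window. -/

theorem le_incumbent_self (J : Q → ℝ) (θ : ℕ → Q) (e : ℕ) : J (θ e) ≤ J (incumbent J θ e) := by
  cases e with
  | zero => exact le_rfl
  | succ e =>
    rw [incumbent]
    split_ifs with h
    · exact le_rfl
    · exact not_lt.1 h

theorem monotone_incumbent (J : Q → ℝ) (θ : ℕ → Q) : Monotone fun e => J (incumbent J θ e) := by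
  refine monotone_nat_of_le_succ fun e => ?_
  change _ ≤ J (incumbent J θ (e + 1))
  rw [incumbent]
  split_ifs with h
  · exact h.le
  · exact le_rfl

theorem le_incumbent (J : Q → ℝ) (θ : ℕ → Q) {i e : ℕ} (h : i ≤ e) :
    J (θ i) ≤ J (incumbent J θ e) :=
  (le_incumbent_self J θ i).trans (monotone_incumbent J θ h)

theorem incumbent_mem {θ : ℕ → Q} (h : ∀ e, θ e ∈ Θ) (e : ℕ) : incumbent J θ e ∈ Θ := by
  induction e with
  | zero => exact h 0
  | succ e ih =>
    rw [incumbent]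
    split_ifs
    · exact h _
    · exact ih

/-- Once an optimal candidate has been tried, the incumbent stays optimal. -/
theorem eventually_incumbent_mem_optimalSet {θ : ℕ → Q} (h : ∀ e, θ e ∈ Θ) {i : ℕ}
    (hi : θ i ∈ optimalSet J Θ) : ∀ᶠ e in atTop, incumbent J θ e ∈ optimalSet J Θ := by
  filter_upwards [eventually_ge_atTop i] with e he
  exact ⟨incumbent_mem h e, fun θ' hθ' => (hi.2 θ' hθ').trans (le_incumbent J θ he)⟩

/-- If the candidates come arbitrarily close to the optimal reward, then the rewards of the
incumbents converge to it. -/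
theorem tendsto_incumbent_reward {θ : ℕ → Q} (h : ∀ e, θ e ∈ Θ) {p : Q} (hp : p ∈ optimalSet J Θ)
    (hs : ∀ n : ℕ, ∃ e, J p - 1 / (n + 1) < J (θ e)) :
    Tendsto (fun e => J (incumbent J θ e)) atTop (𝓝 (J p)) := by
  refine tendsto_order.2 ⟨fun a ha => ?_, fun a ha => ?_⟩
  · obtain ⟨n, hn⟩ := exists_nat_one_div_lt (sub_pos.2 ha)
    obtain ⟨i, hi⟩ := hs n
    filter_upwards [eventually_ge_atTop i] with e he
    have := le_incumbent J θ he
    linarith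
  · exact Eventually.of_forall fun e => (hp.2 _ (incumbent_mem h e)).trans_lt ha

variable [TopologicalSpace Q]

/-- Convergence of the rewards is the only dynamical input. At an accumulation point, `J` takes a
cluster value of a convergent sequence, hence the maximum. -/
theorem convergesToOptimal_of_tendsto {s : ℕ → Q} (hJ : Continuous J) (hs : ∀ e, s e ∈ Θ) {p : Q}
    (hp : p ∈ optimalSet J Θ) (h : Tendsto (fun e => J (s e)) atTop (𝓝 (J p))) :
    ConvergesToOptimal J Θ s := by
  have hcl : ∀ θ ∈ Θ, MapClusterPt θ atTop s → θ ∈ optimalSet J Θ := by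
    intro θ hθ hc
    have h1 : MapClusterPt (J θ) atTop (J ∘ s) := hc.continuousAt_comp hJ.continuousAt
    have h2 : J θ = J p := by
      by_contra hne
      exact (h1.clusterPt.neBot.mono (inf_le_inf_left _ h)).ne
        (disjoint_nhds_nhds.2 hne).eq_bot
    exact ⟨hθ, fun θ' hθ' => h2 ▸ hp.2 θ' hθ'⟩
  refine ⟨fun θ hθ => ?_, hcl, ?_⟩
  · rwa [le_antisymm (hp.2 θ hθ.1) (hθ.2 p hp.1)]
  · rintro ⟨c, ⟨θ, hθ, hc⟩, hK⟩
    have hcp : c < J p := hc.trans_le (hp.2 θ hθ.1)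
    rw [tendsto_iff_eventually]
    intro P hP
    obtain ⟨V, hV, hsub, hVP⟩ := eventually_nhdsSet_iff_exists.1 hP
    by_contra hcon
    -- The rewards eventually exceed `c`, so infinitely many escapes from `V` take place inside a
    -- compact set. They accumulate at a point of `Θ` outside `V`, which would have to be optimal.
    have hfr : ∃ᶠ e in atTop, s e ∈ {θ ∈ Θ | c ≤ J θ} \ V := by
      have h3 : ∃ᶠ e in atTop, ¬ P (s e) := not_eventually.1 hcon
      refine (h3.and_eventually (h.eventually (lt_mem_nhds hcp))).mono ?_
      rintro e ⟨he, hce⟩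
      exact ⟨⟨hs e, hce.le⟩, fun hmem => he (hVP _ hmem)⟩
    obtain ⟨q, hq, hqc⟩ := (hK.diff hV).exists_mapClusterPt_of_frequently hfr
    exact hq.2 (hsub (hcl q hq.1.1 hqc))

theorem IsDenseSearch.exists_mem {θ : ℕ → Q} (h : IsDenseSearch Θ θ) {U : Set Q} (hU : IsOpen U)
    (hne : (U ∩ Θ).Nonempty) : ∃ e, θ e ∈ U := by
  obtain ⟨p, hpU, hpΘ⟩ := hne
  obtain ⟨_, hx, ⟨e, rfl⟩⟩ := mem_closure_iff.1 (h.2 hpΘ) U hU hpU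
  exact ⟨e, hx⟩

/-- Lévy's conditional Borel–Cantelli lemma: divergence of the conditional probabilities forces
infinitely many visits almost surely. One visit is enough here. -/
theorem IsExploringSearch.ae_exists_mem {Ω : Type*} {m : MeasurableSpace Ω} {μ : Measure Ω}
    [IsProbabilityMeasure μ] {ℱ : Filtration ℕ m} {θ : ℕ → Ω → Q}
    (h : IsExploringSearch μ ℱ Θ θ) {U : Set Q} (hU : IsOpen U) (hne : (U ∩ Θ).Nonempty) :
    ∀ᵐ ω ∂μ, ∃ e, θ e ω ∈ U := by
  filter_upwards [h.explores U hU hne,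
    ae_mem_limsup_atTop_iff μ (s := fun e => θ e ⁻¹' U) fun e => h.adapted e U hU] with ω h1 h2
  exact (mem_limsup_iff_frequently_mem.1 (h2.2 h1)).exists

theorem isOpen_superlevel_inter_nonempty (hJ : Continuous J) {p : Q} (hp : p ∈ Θ) (n : ℕ) :
    IsOpen {q | J p - 1 / ((n : ℝ) + 1) < J q} ∧
      ({q | J p - 1 / ((n : ℝ) + 1) < J q} ∩ Θ).Nonempty :=
  ⟨isOpen_lt continuous_const hJ, p,
    show J p - 1 / ((n : ℝ) + 1) < J p from sub_lt_self _ Nat.one_div_pos_of_nat, hp⟩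

theorem IsDenseSearch.convergesToOptimal {θ : ℕ → Q} (h : IsDenseSearch Θ θ) (hJ : Continuous J)
    (hne : (optimalSet J Θ).Nonempty) : ConvergesToOptimal J Θ (incumbent J θ) := by
  obtain ⟨p, hp⟩ := hne
  refine convergesToOptimal_of_tendsto hJ (incumbent_mem h.1) hp
    (tendsto_incumbent_reward h.1 hp fun n => ?_)
  obtain ⟨h1, h2⟩ := isOpen_superlevel_inter_nonempty hJ hp.1 n
  exact h.exists_mem h1 h2

theorem IsExploringSearch.convergesToOptimal {Ω : Type*} {m : MeasurableSpace Ω} {μ : Measure Ω}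
    [IsProbabilityMeasure μ] {ℱ : Filtration ℕ m} {θ : ℕ → Ω → Q}
    (h : IsExploringSearch μ ℱ Θ θ) (hJ : Continuous J) (hne : (optimalSet J Θ).Nonempty) :
    ∀ᵐ ω ∂μ, ConvergesToOptimal J Θ (incumbent J fun e => θ e ω) := by
  obtain ⟨p, hp⟩ := hne
  have hall : ∀ᵐ ω ∂μ, ∀ n : ℕ, ∃ e, J p - 1 / ((n : ℝ) + 1) < J (θ e ω) := by
    -- The exceptional null set depends on the open set, so only the countably many superlevel sets
    -- at heights `J p - 1 / (n + 1)` are used.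
    refine ae_all_iff.2 fun n => ?_
    obtain ⟨h1, h2⟩ := isOpen_superlevel_inter_nonempty hJ hp.1 n
    exact h.ae_exists_mem h1 h2
  filter_upwards [h.mem, hall] with ω h1 h2
  exact convergesToOptimal_of_tendsto hJ (incumbent_mem h1) hp (tendsto_incumbent_reward h1 hp h2)

theorem IsDenseSearch.eventually_mem_optimalSet {θ : ℕ → Q} (h : IsDenseSearch Θ θ) {U : Set Q}
    (hU : IsOpen U) (heq : optimalSet J Θ = Θ ∩ U) (hne : (Θ ∩ U).Nonempty) :
    ∀ᶠ e in atTop, incumbent J θ e ∈ optimalSet J Θ := by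
  obtain ⟨e, he⟩ := h.exists_mem hU (inter_comm Θ U ▸ hne)
  exact eventually_incumbent_mem_optimalSet h.1 (heq ▸ ⟨h.1 e, he⟩ : θ e ∈ optimalSet J Θ)

theorem IsExploringSearch.eventually_mem_optimalSet {Ω : Type*} {m : MeasurableSpace Ω}
    {μ : Measure Ω} [IsProbabilityMeasure μ] {ℱ : Filtration ℕ m} {θ : ℕ → Ω → Q}
    (h : IsExploringSearch μ ℱ Θ θ) {U : Set Q}
    (hU : IsOpen U) (heq : optimalSet J Θ = Θ ∩ U) (hne : (Θ ∩ U).Nonempty) :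
    ∀ᵐ ω ∂μ, ∀ᶠ e in atTop, incumbent J (fun e' => θ e' ω) e ∈ optimalSet J Θ := by
  filter_upwards [h.mem, h.ae_exists_mem hU (inter_comm Θ U ▸ hne)] with ω h1 ⟨e, he⟩
  exact eventually_incumbent_mem_optimalSet (θ := fun e' => θ e' ω) (i := e) h1
    (heq ▸ ⟨h1 e, he⟩)

end SearchConvergence

/-! ### Weak convergence with varying integrands -/

section WeakConvergence

variable {X : Type*} [MetricSpace X]

/-- The lower Lipschitz envelope of the tail `h k, h (k + 1), …` of a sequence of functions. -/
noncomputable def tailEnvelope (h : ℕ → X → ℝ) (k : ℕ) (x : X) : ℝ :=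
  ⨅ p : {n : ℕ // k ≤ n} × X, (h p.1 p.2 + k * dist x p.2)

section Envelope

variable {h : ℕ → X → ℝ} {C : ℝ}

theorem bddBelow_tailEnvelope (hC : ∀ n x, |h n x| ≤ C) (k : ℕ) (x : X) :
    BddBelow (range fun p : {n : ℕ // k ≤ n} × X => h p.1 p.2 + k * dist x p.2) := by
  refine ⟨-C, ?_⟩
  rintro _ ⟨p, rfl⟩
  have h1 := (abs_le.1 (hC p.1 p.2)).1
  have h2 : 0 ≤ (k : ℝ) * dist x p.2 := by positivity
  change -C ≤ h p.1 p.2 + k * dist x p.2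
  linarith

theorem tailEnvelope_le (hC : ∀ n x, |h n x| ≤ C) {k n : ℕ} (hn : k ≤ n) (x : X) :
    tailEnvelope h k x ≤ h n x := by
  refine (ciInf_le (bddBelow_tailEnvelope hC k x) (⟨n, hn⟩, x)).trans ?_
  simp

theorem abs_tailEnvelope_le (hC : ∀ n x, |h n x| ≤ C) (k : ℕ) (x : X) :
    |tailEnvelope h k x| ≤ C := by
  refine abs_le.2 ⟨?_, (tailEnvelope_le hC le_rfl x).trans (abs_le.1 (hC k x)).2⟩
  have : Nonempty ({n : ℕ // k ≤ n} × X) := ⟨(⟨k, le_rfl⟩, x)⟩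
  refine le_ciInf fun p => ?_
  have h1 := (abs_le.1 (hC p.1 p.2)).1
  have h2 : 0 ≤ (k : ℝ) * dist x p.2 := by positivity
  linarith

theorem lipschitzWith_tailEnvelope (hC : ∀ n x, |h n x| ≤ C) (k : ℕ) :
    LipschitzWith k (tailEnvelope h k) := by
  refine LipschitzWith.of_le_add_mul _ fun x y => ?_
  rw [← sub_le_iff_le_add]
  have : Nonempty ({n : ℕ // k ≤ n} × X) := ⟨(⟨k, le_rfl⟩, x)⟩
  refine le_ciInf fun p => ?_
  have h1 : tailEnvelope h k x ≤ h p.1 p.2 + k * dist x p.2 :=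
    ciInf_le (bddBelow_tailEnvelope hC k x) p
  have h2 : (k : ℝ) * dist x p.2 ≤ k * dist x y + k * dist y p.2 := by
    rw [← mul_add]
    exact mul_le_mul_of_nonneg_left (dist_triangle _ _ _) k.cast_nonneg
  simp only [NNReal.coe_natCast]
  linarith

/-- Near `x` all late functions are close to `y`; away from `x` the penalty `k * dist` outgrows the
uniform bound `C`. So the infimum cannot drop below `y` in the limit. -/
theorem tendsto_tailEnvelope (hC : ∀ n x, |h n x| ≤ C) {x : X} {y : ℝ}
    (hx : Tendsto (fun p : ℕ × X => h p.1 p.2) (atTop ×ˢ 𝓝 x) (𝓝 y)) :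
    Tendsto (fun k => tailEnvelope h k x) atTop (𝓝 y) := by
  refine tendsto_order.2 ⟨fun a ha => ?_, fun a ha => ?_⟩
  · obtain ⟨a', haa', ha'⟩ := exists_between ha
    obtain ⟨P, hP, R, hR, hPR⟩ := eventually_prod_iff.1 (hx.eventually (lt_mem_nhds ha'))
    obtain ⟨N, hN⟩ := eventually_atTop.1 hP
    obtain ⟨δ, hδ, hball⟩ := Metric.eventually_nhds_iff.1 hR
    -- For `k ≥ N'`, a point at distance at least `δ` contributes at least `-C + k * δ > a'`.
    obtain ⟨N', hN'⟩ := exists_nat_gt ((a' + C) / δ)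
    filter_upwards [eventually_ge_atTop N, eventually_ge_atTop N'] with k hk hk'
    refine haa'.trans_le ?_
    have : Nonempty ({n : ℕ // k ≤ n} × X) := ⟨(⟨k, le_rfl⟩, x)⟩
    refine le_ciInf fun p => ?_
    rcases lt_or_ge (dist p.2 x) δ with hd | hd
    · have h1 : a' < h p.1 p.2 := hPR (hN p.1 (hk.trans p.1.2)) (hball hd)
      have h2 : 0 ≤ (k : ℝ) * dist x p.2 := by positivity
      linarith
    · have h1 := (abs_le.1 (hC p.1 p.2)).1
      have h2 : a' + C < N' * δ := (div_lt_iff₀ hδ).1 hN'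
      have h3 : (N' : ℝ) * δ ≤ k * dist x p.2 := by
        rw [dist_comm]
        exact mul_le_mul (Nat.cast_le.2 hk') hd hδ.le k.cast_nonneg
      linarith
  · have h1 : Tendsto (fun n : ℕ => (n, x)) atTop (atTop ×ˢ 𝓝 x) :=
      tendsto_id.prodMk tendsto_const_nhds
    filter_upwards [(hx.comp h1).eventually (gt_mem_nhds ha)] with k hk
    exact (tailEnvelope_le hC le_rfl x).trans_lt hk

end Envelope

variable [MeasurableSpace X] [BorelSpace X]

/-- The envelope is a single bounded continuous minorant of all `h n` with `n ≥ k`. Fixing `k` first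
makes weak convergence applicable to it; dominated convergence in `k` shows that little is lost. The
matching upper bound comes from applying this to `-h n`. -/
theorem eventually_lt_integral_of_tendsto {μs : ℕ → Measure X} {μ : Measure X}
    [∀ n, IsProbabilityMeasure (μs n)] [IsProbabilityMeasure μ]
    (hμ : ∀ g : BoundedContinuousFunction X ℝ,
      Tendsto (fun n => ∫ x, g x ∂(μs n)) atTop (𝓝 (∫ x, g x ∂μ)))
    {h : ℕ → X → ℝ} {h' : X → ℝ} {C : ℝ} (hm : ∀ n, Measurable (h n))
    (hC : ∀ n x, |h n x| ≤ C)
    (hlim : ∀ᵐ x ∂μ, Tendsto (fun p : ℕ × X => h p.1 p.2) (atTop ×ˢ 𝓝 x) (𝓝 (h' x)))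
    {a : ℝ} (ha : a < ∫ x, h' x ∂μ) : ∀ᶠ n in atTop, a < ∫ x, h n x ∂(μs n) := by
  have hcont : ∀ k, Continuous (tailEnvelope h k) := fun k =>
    (lipschitzWith_tailEnvelope hC k).continuous
  have h1 : Tendsto (fun k => ∫ x, tailEnvelope h k x ∂μ) atTop (𝓝 (∫ x, h' x ∂μ)) :=
    tendsto_integral_of_dominated_convergence (fun _ => C)
      (fun k => (hcont k).measurable.aestronglyMeasurable) (integrable_const C)
      (fun k => Eventually.of_forall fun x => abs_tailEnvelope_le hC k x)
      (hlim.mono fun x hx => tendsto_tailEnvelope hC hx)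
  obtain ⟨k, hk⟩ := (h1.eventually (lt_mem_nhds ha)).exists
  have h2 := hμ (BoundedContinuousFunction.ofNormedAddCommGroup (tailEnvelope h k) (hcont k) C
    (abs_tailEnvelope_le hC k))
  filter_upwards [h2.eventually (lt_mem_nhds hk), eventually_ge_atTop k] with n hn hkn
  refine hn.trans_le (integral_mono ?_ ?_ fun x => tailEnvelope_le hC hkn x)
  · exact Integrable.of_bound (hcont k).measurable.aestronglyMeasurable C
      (Eventually.of_forall (abs_tailEnvelope_le hC k))
  · exact Integrable.of_bound (hm n).aestronglyMeasurable C (Eventually.of_forall (hC n))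

/-- If `μs n → μ` weakly and the uniformly bounded functions `h n` converge continuously to `h'`
at `μ`-almost every point, then their integrals converge. -/
theorem tendsto_integral_of_tendsto_of_continuously {μs : ℕ → Measure X} {μ : Measure X}
    [∀ n, IsProbabilityMeasure (μs n)] [IsProbabilityMeasure μ]
    (hμ : ∀ g : BoundedContinuousFunction X ℝ,
      Tendsto (fun n => ∫ x, g x ∂(μs n)) atTop (𝓝 (∫ x, g x ∂μ)))
    {h : ℕ → X → ℝ} {h' : X → ℝ} {C : ℝ} (hm : ∀ n, Measurable (h n))
    (hC : ∀ n x, |h n x| ≤ C)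
    (hlim : ∀ᵐ x ∂μ, Tendsto (fun p : ℕ × X => h p.1 p.2) (atTop ×ˢ 𝓝 x) (𝓝 (h' x))) :
    Tendsto (fun n => ∫ x, h n x ∂(μs n)) atTop (𝓝 (∫ x, h' x ∂μ)) := by
  refine tendsto_order.2 ⟨fun a ha => eventually_lt_integral_of_tendsto hμ hm hC hlim ha,
    fun a ha => ?_⟩
  have h1 : -a < ∫ x, -h' x ∂μ := by rw [integral_neg]; exact neg_lt_neg ha
  have h2 := eventually_lt_integral_of_tendsto hμ (h := fun n x => -h n x) (C := C)
    (fun n => (hm n).neg) (fun n x => (abs_neg _).trans_le (hC n x))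
    (hlim.mono fun x hx => hx.neg) h1
  filter_upwards [h2] with n hn
  rw [integral_neg] at hn
  exact neg_lt_neg_iff.1 hn

end WeakConvergence

theorem abs_integral_le_of_abs_le {α : Type*} [MeasurableSpace α] {μ : Measure α}
    [IsProbabilityMeasure μ] {f : α → ℝ} {C : ℝ} (h : ∀ x, |f x| ≤ C) : |∫ x, f x ∂μ| ≤ C := by
  simpa using norm_integral_le_of_norm_le_const (μ := μ) (f := f) (Eventually.of_forall h)

/-! ### Continuity of the total reward in the parameters -/

namespace ControlProblem

section Laws

variable {X : Type*} [MeasurableSpace X] {d k M : ℕ}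
variable (S : ControlProblem X d k M) (κ : ControlModel d k)

instance (θ : Fin M → κ.Param) : IsProbabilityMeasure (S.episodeLaw κ θ) := by
  unfold episodeLaw
  infer_instance

/-- Law of the state at time `t` under the policy with parameters `θ`. -/
noncomputable def stateLaw (θ : Fin M → κ.Param) (t : ℕ) : Measure X :=
  (S.episodeLaw κ θ).map fun x => x t

instance (θ : Fin M → κ.Param) (t : ℕ) : IsProbabilityMeasure (S.stateLaw κ θ t) :=
  Measure.isProbabilityMeasure_map (measurable_pi_apply t).aemeasurable

theorem stateLaw_zero (θ : Fin M → κ.Param) : S.stateLaw κ θ 0 = S.init := by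
  have h : (fun x : ℕ → X => x 0) =
      (fun h : (Finset.Iic 0 → X) => h ⟨0, Finset.mem_Iic.2 le_rfl⟩) ∘
        Preorder.frestrictLe (π := fun _ => X) 0 := rfl
  rw [stateLaw, h, ← Measure.map_map (by fun_prop) (by fun_prop), episodeLaw, Kernel.trajMeasure,
    Measure.map_comp _ _ (by fun_prop), Kernel.traj_map_frestrictLe, Kernel.partialTraj_self,
    Measure.id_comp, Measure.map_map (by fun_prop) (by fun_prop)]
  exact Measure.map_id

/-- The trajectory measure disintegrates over the whole history up to `t`. As the kernel reads only
the last state, projecting the history to that state gives the Markov property for consecutive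
pairs. -/
theorem map_episodeLaw_pair (θ : Fin M → κ.Param) (t : ℕ) :
    (S.episodeLaw κ θ).map (fun x => (x t, x (t + 1))) =
      S.stateLaw κ θ t ⊗ₘ S.closedLoop κ θ := by
  have key := Kernel.map_frestrictLe_trajMeasure_compProd_eq_map_trajMeasure
    (X := fun _ => X) (μ₀ := S.init) (a := t) (κ := fun t =>
    (S.closedLoop κ θ).comap (fun h : (Finset.Iic t → X) => h ⟨t, Finset.mem_Iic.2 le_rfl⟩)
      (measurable_pi_apply _))
  refine Measure.ext_of_lintegral _ fun f hf => ?_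
  have hf' : Measurable fun q : (Finset.Iic t → X) × X =>
      f (q.1 ⟨t, Finset.mem_Iic.2 le_rfl⟩, q.2) := by fun_prop
  have h1 := congrArg (fun ν => ∫⁻ q, f (q.1 ⟨t, Finset.mem_Iic.2 le_rfl⟩, q.2) ∂ν) key
  have hin : Measurable fun x : X => ∫⁻ y, f (x, y) ∂(S.closedLoop κ θ x) :=
    hf.lintegral_kernel_prod_right'
  beta_reduce at h1
  rw [Measure.lintegral_compProd hf', lintegral_map hf' (by fun_prop)] at h1
  rw [lintegral_map hf (by fun_prop), Measure.lintegral_compProd hf, stateLaw,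
    lintegral_map hin (by fun_prop)]
  refine h1.symm.trans ?_
  simp only [Kernel.comap_apply]
  exact lintegral_map (hin.comp (measurable_pi_apply (⟨t, Finset.mem_Iic.2 le_rfl⟩ :
    Finset.Iic t))) (by fun_prop)

theorem stateLaw_succ (θ : Fin M → κ.Param) (t : ℕ) :
    S.stateLaw κ θ (t + 1) = (S.stateLaw κ θ t).bind (S.closedLoop κ θ) := by
  rw [← Measure.snd_compProd, ← map_episodeLaw_pair, Measure.snd, Measure.map_map (by fun_prop)
    (by fun_prop)]
  rfl

theorem integral_episodeLaw_pair (θ : Fin M → κ.Param) (t : ℕ) {g : X × X → ℝ}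
    (hg : Measurable g) {C : ℝ} (hC : ∀ q, |g q| ≤ C) :
    ∫ x, g (x t, x (t + 1)) ∂(S.episodeLaw κ θ) =
      ∫ x, ∫ x', g (x, x') ∂(S.trans (x, S.policy κ θ x)) ∂(S.stateLaw κ θ t) := by
  have h : ∫ x, g (x t, x (t + 1)) ∂(S.episodeLaw κ θ) =
      ∫ q, g q ∂((S.episodeLaw κ θ).map (fun x => (x t, x (t + 1)))) :=
    (integral_map (by fun_prop) hg.aestronglyMeasurable).symm
  rw [h, map_episodeLaw_pair, Measure.integral_compProd]
  · rfl
  · exact Integrable.of_bound hg.aestronglyMeasurable C (Eventually.of_forall hC)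

theorem integral_stateLaw_succ (θ : Fin M → κ.Param) (t : ℕ) {g : X → ℝ} (hg : Measurable g)
    {C : ℝ} (hC : ∀ x, |g x| ≤ C) :
    ∫ x, g x ∂(S.stateLaw κ θ (t + 1)) =
      ∫ x, ∫ x', g x' ∂(S.trans (x, S.policy κ θ x)) ∂(S.stateLaw κ θ t) := by
  rw [stateLaw, integral_map (measurable_pi_apply _).aemeasurable hg.aestronglyMeasurable]
  exact S.integral_episodeLaw_pair κ θ t (g := fun q => g q.2) (by fun_prop) fun q => hC q.2

end Laws

section Continuity

variable {X : Type*} [TopologicalSpace X] [MeasurableSpace X] {d k M : ℕ}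
  {S : ControlProblem X d k M} (κ : ControlModel d k)

/-- The policy may be discontinuous in the state only on these frontiers, so at every time it is
continuous at almost every state. -/
theorem IsRegular.stateLaw_frontier [BorelSpace X]
    (hS : S.IsRegular) (θ : Fin M → κ.Param) (t : ℕ) (m : Fin M) :
    S.stateLaw κ θ t (frontier (S.region ⁻¹' {m})) = 0 := by
  cases t with
  | zero => rw [stateLaw_zero]; exact hS.init_frontier m
  | succ t =>
    rw [stateLaw_succ, Measure.bind_apply isClosed_frontier.measurableSet
      (S.closedLoop κ θ).aemeasurable]
    simp only [closedLoop, Kernel.comap_apply, hS.trans_frontier, lintegral_zero]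

/-- Off the frontiers the region index is locally constant, so locally a single jointly continuous
control law is in force. -/
theorem IsRegular.tendsto_policy (hS : S.IsRegular) {θs : ℕ → Fin M → κ.Param}
    {θ : Fin M → κ.Param} (hθ : Tendsto θs atTop (𝓝 θ)) {x : X}
    (hx : ∀ m, x ∉ frontier (S.region ⁻¹' {m})) :
    Tendsto (fun p : ℕ × X => S.policy κ (θs p.1) p.2) (atTop ×ˢ 𝓝 x)
      (𝓝 (S.policy κ θ x)) := by
  have hloc : ∀ᶠ y in 𝓝 x, S.region y = S.region x := by
    have hmem : x ∈ closure (S.region ⁻¹' {S.region x}) := subset_closure rfl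
    have h1 : x ∈ interior (S.region ⁻¹' {S.region x}) := by
      by_contra hn
      exact hx _ ⟨hmem, hn⟩
    exact mem_interior_iff_mem_nhds.1 h1
  have h2 : Tendsto (fun p : ℕ × X => (θs p.1 (S.region x), S.output p.2)) (atTop ×ˢ 𝓝 x)
      (𝓝 (θ (S.region x), S.output x)) :=
    Tendsto.prodMk_nhds (((tendsto_pi_nhds.1 hθ _)).comp tendsto_fst)
      ((hS.continuous_output.tendsto x).comp tendsto_snd)
  refine ((κ.continuous_law.tendsto _).comp h2).congr' ?_
  filter_upwards [tendsto_snd.eventually hloc] with p hp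
  simp only [policy, hp, Function.comp]

/-- Integrals of `F (xₜ, aₜ)` depend continuously on the parameters as soon as the law of `xₜ`
depends weakly continuously on them. -/
theorem IsRegular.tendsto_integral_policy [TopologicalSpace.MetrizableSpace X] [BorelSpace X]
    (hS : S.IsRegular) {θs : ℕ → Fin M → κ.Param}
    {θ : Fin M → κ.Param} (hθ : Tendsto θs atTop (𝓝 θ)) (t : ℕ)
    (hμ : ∀ g : BoundedContinuousFunction X ℝ,
      Tendsto (fun n => ∫ x, g x ∂(S.stateLaw κ (θs n) t)) atTop
        (𝓝 (∫ x, g x ∂(S.stateLaw κ θ t))))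
    {F : X × (Fin k → ℝ) → ℝ} (hF : Continuous F) {C : ℝ} (hC : ∀ q, |F q| ≤ C) :
    Tendsto (fun n => ∫ x, F (x, S.policy κ (θs n) x) ∂(S.stateLaw κ (θs n) t)) atTop
      (𝓝 (∫ x, F (x, S.policy κ θ x) ∂(S.stateLaw κ θ t))) := by
  let := TopologicalSpace.metrizableSpaceMetric X
  refine tendsto_integral_of_tendsto_of_continuously hμ (C := C)
    (h := fun n x => F (x, S.policy κ (θs n) x)) (fun n => ?_) (fun n x => hC _) ?_
  · exact hF.measurable.comp (measurable_id.prodMk (S.measurable_policy κ _))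
  · have h0 : ∀ᵐ x ∂(S.stateLaw κ θ t), ∀ m, x ∉ frontier (S.region ⁻¹' {m}) :=
      ae_all_iff.2 fun m => measure_eq_zero_iff_ae_notMem.1 (hS.stateLaw_frontier κ θ t m)
    filter_upwards [h0] with x hx
    exact (hF.tendsto _).comp
      (Tendsto.prodMk_nhds tendsto_snd (hS.tendsto_policy κ hθ hx))

theorem IsRegular.tendsto_integral_stateLaw [TopologicalSpace.MetrizableSpace X] [BorelSpace X]
    (hS : S.IsRegular) {θs : ℕ → Fin M → κ.Param}
    {θ : Fin M → κ.Param} (hθ : Tendsto θs atTop (𝓝 θ)) (t : ℕ)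
    (g : BoundedContinuousFunction X ℝ) :
    Tendsto (fun n => ∫ x, g x ∂(S.stateLaw κ (θs n) t)) atTop
        (𝓝 (∫ x, g x ∂(S.stateLaw κ θ t))) := by
  induction t generalizing g with
  | zero => simp only [stateLaw_zero]; exact tendsto_const_nhds
  | succ t ih =>
    have hg : ∀ x, |g x| ≤ ‖g‖ := fun x => g.norm_coe_le_norm x
    simp only [fun θ => S.integral_stateLaw_succ κ θ t g.continuous.measurable hg]
    -- One step of the chain turns `g` into its mean under the transition kernel, a bounded
    -- continuous function of state and action by weak continuity; the induction hypothesis covers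
    -- the state at time `t`.
    refine hS.tendsto_integral_policy κ hθ t ih (hS.continuous_trans g) (C := ‖g‖) fun q =>
      abs_integral_le_of_abs_le hg

/-- The expected reward of one transition, as a function of the state and the action. -/
theorem IsRegular.continuous_expectedReward [TopologicalSpace.MetrizableSpace X] [BorelSpace X]
    (hS : S.IsRegular) :
    Continuous fun q : X × (Fin k → ℝ) => ∫ x', S.reward q.1 q.2 x' ∂(S.trans q) := by
  let := TopologicalSpace.metrizableSpaceMetric X
  obtain ⟨C, hC⟩ := hS.bounded_reward
  refine continuous_iff_seqContinuous.2 fun qs q hq => ?_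
  refine tendsto_integral_of_tendsto_of_continuously (μs := fun n => S.trans (qs n)) (C := C)
    (h := fun n x' => S.reward (qs n).1 (qs n).2 x')
    (fun g => ((hS.continuous_trans g).tendsto q).comp hq) (fun n => ?_) (fun n x => hC _ _ _) ?_
  · exact (hS.continuous_reward.comp (f := fun x' => ((qs n).1, (qs n).2, x'))
      (by fun_prop)).measurable
  · refine Eventually.of_forall fun x => ?_
    have h1 : Tendsto (fun p : ℕ × X => ((qs p.1).1, (qs p.1).2, p.2)) (atTop ×ˢ 𝓝 x)
        (𝓝 (q.1, q.2, x)) := by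
      have h2 := hq.comp (tendsto_fst (f := atTop) (g := 𝓝 x))
      exact Tendsto.prodMk_nhds ((continuous_fst.tendsto q).comp h2)
        (Tendsto.prodMk_nhds ((continuous_snd.tendsto q).comp h2) tendsto_snd)
    exact (hS.continuous_reward.tendsto _).comp h1

/-- Second countability makes the product σ-algebra Borel, so that joint continuity of the reward
yields joint measurability. -/
theorem IsRegular.measurable_reward_policy [SecondCountableTopology X] [BorelSpace X]
    (hS : S.IsRegular) (θ : Fin M → κ.Param) :
    Measurable fun q : X × X => S.reward q.1 (S.policy κ θ q.1) q.2 :=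
  hS.continuous_reward.measurable.comp (measurable_fst.prodMk
    (((S.measurable_policy κ θ).comp measurable_fst).prodMk measurable_snd))

theorem IsRegular.continuous_integral_reward [TopologicalSpace.MetrizableSpace X]
    [SecondCountableTopology X] [BorelSpace X]
    (hS : S.IsRegular) (t : ℕ) :
    Continuous fun θ : Fin M → κ.Param =>
      ∫ x : ℕ → X, S.reward (x t) (S.policy κ θ (x t)) (x (t + 1)) ∂(S.episodeLaw κ θ) := by
  obtain ⟨C, hC⟩ := hS.bounded_reward
  have heq : ∀ θ : Fin M → κ.Param,
      ∫ x : ℕ → X, S.reward (x t) (S.policy κ θ (x t)) (x (t + 1)) ∂(S.episodeLaw κ θ) =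
        ∫ x, ∫ x', S.reward x (S.policy κ θ x) x' ∂(S.trans (x, S.policy κ θ x))
          ∂(S.stateLaw κ θ t) := fun θ =>
    S.integral_episodeLaw_pair κ θ t (hS.measurable_reward_policy κ θ) fun q => hC _ _ _
  simp only [heq]
  refine continuous_iff_seqContinuous.2 fun θs θ hθ => ?_
  refine hS.tendsto_integral_policy κ hθ t (hS.tendsto_integral_stateLaw κ hθ t)
    hS.continuous_expectedReward (C := C) fun q =>
      abs_integral_le_of_abs_le (hC q.1 q.2)

theorem IsRegular.continuous_totalReward [TopologicalSpace.MetrizableSpace X]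
    [SecondCountableTopology X] [BorelSpace X]
    (hS : S.IsRegular) : Continuous (S.totalReward κ) := by
  obtain ⟨C, hC⟩ := hS.bounded_reward
  have hbound : ∀ (t : ℕ) (θ : Fin M → κ.Param) (x : ℕ → X),
      ‖S.γ ^ t * S.reward (x t) (S.policy κ θ (x t)) (x (t + 1))‖ ≤ S.γ ^ t * C := fun t θ x => by
    rw [norm_mul, norm_pow, Real.norm_of_nonneg hS.γ_nonneg]
    exact mul_le_mul_of_nonneg_left (hC _ _ _) (pow_nonneg hS.γ_nonneg t)
  have hsum : Summable fun t : ℕ => S.γ ^ t * C :=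
    (summable_geometric_of_lt_one hS.γ_nonneg hS.γ_lt_one).mul_right C
  have hint : ∀ (θ : Fin M → κ.Param) (t : ℕ), Integrable (fun x : ℕ → X =>
      S.γ ^ t * S.reward (x t) (S.policy κ θ (x t)) (x (t + 1))) (S.episodeLaw κ θ) := fun θ t =>
    Integrable.of_bound (((hS.measurable_reward_policy κ θ).comp
      (g := fun q : X × X => S.reward q.1 (S.policy κ θ q.1) q.2)
      (f := fun x : ℕ → X => (x t, x (t + 1)))
      ((measurable_pi_apply t).prodMk (measurable_pi_apply (t + 1)))).const_mul
        (S.γ ^ t)).aestronglyMeasurable (S.γ ^ t * C) (Eventually.of_forall (hbound t θ))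
  -- The bound `γ ^ t * C` serves twice: it allows sum and expectation to be exchanged, and it is
  -- the majorant in the Weierstrass test for continuity.
  have heq : S.totalReward κ = fun θ => ∑' t : ℕ, ∫ x : ℕ → X,
      S.γ ^ t * S.reward (x t) (S.policy κ θ (x t)) (x (t + 1)) ∂(S.episodeLaw κ θ) := by
    funext θ
    refine (hasSum_integral_of_summable_integral_norm (hint θ) ?_).tsum_eq.symm
    refine hsum.of_nonneg_of_le (fun t => integral_nonneg fun x => norm_nonneg _) fun t => ?_
    refine (integral_mono (hint θ t).norm (integrable_const _) (hbound t θ)).trans ?_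
    simp
  rw [heq]
  refine continuous_tsum (fun t => ?_) hsum fun t θ =>
    abs_integral_le_of_abs_le (hbound t θ)
  simp only [integral_const_mul]
  exact (hS.continuous_integral_reward κ t).const_mul _

end Continuity

end ControlProblem

/-! ### Robustness of exponential stability in discrete time -/

section DiscreteRobustness

variable {E : Type*} [NormedAddCommGroup E]

/-- Local exponential stability, uniform in the starting time, of the equilibrium `x₀` of
`x_{j+1} = F j x_j`. -/
def IsExpStableDiscrete (F : ℕ → E → E) (x₀ : E) : Prop :=
  ∃ c > 0, ∃ q > 0, q < 1 ∧ ∃ δ > 0, ∀ j₀ : ℕ, ∀ x : ℕ → E,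
    (∀ j ≥ j₀, x (j + 1) = F j (x j)) → ‖x j₀ - x₀‖ < δ →
    ∀ i : ℕ, ‖x (j₀ + i) - x₀‖ ≤ c * q ^ i * ‖x j₀ - x₀‖

variable {F F' : ℕ → E → E} {x₀ : E} {K : NNReal}

theorem norm_sub_le_pow_of_linear_growth {G : ℝ} (hG : 0 ≤ G)
    (hF : ∀ j x, ‖F j x - x₀‖ ≤ G * ‖x - x₀‖) {x : ℕ → E} {j₀ : ℕ}
    (hx : ∀ j ≥ j₀, x (j + 1) = F j (x j)) (i : ℕ) :
    ‖x (j₀ + i) - x₀‖ ≤ G ^ i * ‖x j₀ - x₀‖ := by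
  induction i with
  | zero => simp
  | succ i ih =>
    rw [← add_assoc, hx _ (Nat.le_add_right _ _), pow_succ', mul_assoc]
    exact (hF _ _).trans (mul_le_mul_of_nonneg_left ih hG)

theorem exists_trajectory_from {α : Type*} (F : ℕ → α → α) (j₀ : ℕ) (a : α) :
    ∃ y : ℕ → α, y j₀ = a ∧ ∀ j ≥ j₀, y (j + 1) = F j (y j) := by
  refine ⟨fun j => Nat.rec a (fun i z => F (j₀ + i) z) (j - j₀), by simp, fun j hj => ?_⟩
  obtain ⟨i, rfl⟩ := Nat.exists_eq_add_of_le hj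
  simp only [add_assoc, Nat.add_sub_cancel_left]

theorem norm_sub_le_of_perturbed (hF : ∀ j, LipschitzWith K (F j)) (hx₀ : ∀ j, F j x₀ = x₀)
    {ε : ℝ} (hε1 : ε ≤ 1) (hFF' : ∀ j x, ‖F' j x - F j x‖ ≤ ε * ‖x - x₀‖) (j : ℕ) (x : E) :
    ‖F' j x - x₀‖ ≤ (K + 2) * ‖x - x₀‖ := by
  have h1 : ‖F j x - x₀‖ ≤ K * ‖x - x₀‖ := by
    simpa only [hx₀, dist_eq_norm] using (hF j).dist_le_mul x x₀
  have h2 := norm_add_le (F' j x - F j x) (F j x - x₀)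
  rw [sub_add_sub_cancel] at h2
  have h3 : ε * ‖x - x₀‖ ≤ 1 * ‖x - x₀‖ := mul_le_mul_of_nonneg_right hε1 (norm_nonneg _)
  linarith [hFF' j x, norm_nonneg (x - x₀)]

/-- A discrete Gronwall argument: each step multiplies the error by at most `K` and adds at most `ε`
times the current deviation from `x₀`, which itself grows by at most `K + 2` per step. The induction
closes because `K + 1 ≤ K + 2`. -/
theorem norm_trajectory_sub_le_of_perturbed (hF : ∀ j, LipschitzWith K (F j))
    (hx₀ : ∀ j, F j x₀ = x₀) {ε : ℝ} (hε : 0 ≤ ε) (hε1 : ε ≤ 1)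
    (hFF' : ∀ j x, ‖F' j x - F j x‖ ≤ ε * ‖x - x₀‖) {x y : ℕ → E} {j₀ : ℕ}
    (hx : ∀ j ≥ j₀, x (j + 1) = F' j (x j)) (hy : ∀ j ≥ j₀, y (j + 1) = F j (y j))
    (hxy : y j₀ = x j₀) (i : ℕ) :
    ‖x (j₀ + i) - y (j₀ + i)‖ ≤ ε * (K + 2) ^ i * ‖x j₀ - x₀‖ := by
  have hK := K.coe_nonneg
  induction i with
  | zero =>
    rw [add_zero, hxy, sub_self, norm_zero]
    positivity
  | succ i ih =>
    have hgrow := norm_sub_le_pow_of_linear_growth (by positivity)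
      (norm_sub_le_of_perturbed hF hx₀ hε1 hFF') hx i
    have hj : j₀ + i ≥ j₀ := Nat.le_add_right _ _
    rw [← add_assoc, hx _ hj, hy _ hj]
    have h1 := norm_add_le (F' (j₀ + i) (x (j₀ + i)) - F (j₀ + i) (x (j₀ + i)))
      (F (j₀ + i) (x (j₀ + i)) - F (j₀ + i) (y (j₀ + i)))
    rw [sub_add_sub_cancel] at h1
    have h2 : ‖F (j₀ + i) (x (j₀ + i)) - F (j₀ + i) (y (j₀ + i))‖ ≤
        K * ‖x (j₀ + i) - y (j₀ + i)‖ := by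
      simpa only [dist_eq_norm] using (hF (j₀ + i)).dist_le_mul (x (j₀ + i)) (y (j₀ + i))
    have h3 := mul_le_mul_of_nonneg_left ih hK
    have h4 := mul_le_mul_of_nonneg_left hgrow hε
    have h5 : 0 ≤ ε * (K + 2) ^ i * ‖x j₀ - x₀‖ := by positivity
    have h6 := hFF' (j₀ + i) (x (j₀ + i))
    rw [pow_succ]
    nlinarith

theorem half_pow_div_le {N : ℕ} (hN : 0 < N) :
    ∃ q : ℝ, 0 < q ∧ q < 1 ∧ ∀ i : ℕ, (1 / 2 : ℝ) ^ (i / N) ≤ 2 * q ^ i := by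
  -- The `N`-th root of 1/2; the prefactor 2 is `q ^ (-N)` and pays for the incomplete last window.
  set q : ℝ := (1 / 2 : ℝ) ^ ((N : ℝ)⁻¹)
  have hq0 : 0 < q := Real.rpow_pos_of_pos (by norm_num) _
  have hq1 : q < 1 := Real.rpow_lt_one (by norm_num) (by norm_num)
    (inv_pos.2 (Nat.cast_pos.2 hN))
  have hqN : q ^ N = 1 / 2 := Real.rpow_inv_natCast_pow (by norm_num) hN.ne'
  refine ⟨q, hq0, hq1, fun i => ?_⟩
  calc (1 / 2 : ℝ) ^ (i / N) = 2 * (q ^ N * q ^ (N * (i / N))) := by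
        rw [pow_mul, hqN]; ring
    _ ≤ 2 * (q ^ (i % N) * q ^ (N * (i / N))) := by
        gcongr ?_ * (?_ * _)
        exact pow_le_pow_of_le_one hq0.le hq1.le (Nat.mod_lt i hN).le
    _ = 2 * q ^ i := by rw [← pow_add, Nat.mod_add_div]

/-- Local exponential stability is robust under small perturbations vanishing linearly at the
equilibrium. -/
theorem IsExpStableDiscrete.exists_robust (hF : ∀ j, LipschitzWith K (F j))
    (hx₀ : ∀ j, F j x₀ = x₀) (hst : IsExpStableDiscrete F x₀) :
    ∃ ε > 0, ∀ F' : ℕ → E → E, (∀ j x, ‖F' j x - F j x‖ ≤ ε * ‖x - x₀‖) →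
      IsExpStableDiscrete F' x₀ := by
  obtain ⟨c, hc, q, hq, hq1, δ, hδ, hst⟩ := hst
  have hlim : Tendsto (fun N : ℕ => c * q ^ N) atTop (𝓝 0) := by
    simpa using (tendsto_pow_atTop_nhds_zero_of_lt_one hq.le hq1).const_mul c
  obtain ⟨N, hcq, hN⟩ := ((hlim.eventually (gt_mem_nhds (by norm_num : (0 : ℝ) < 1 / 4))).and
    (eventually_gt_atTop 0)).exists
  have hK := K.coe_nonneg
  have hG1 : (1 : ℝ) ≤ K + 2 := by linarith
  -- `G` bounds the growth over one window of `N` steps. With `ε = 1 / (4 * G)` the two trajectories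
  -- differ by at most 1/4 of the initial deviation after `N` steps, complementing the nominal
  -- contraction `c * q ^ N < 1 / 4`.
  set G : ℝ := (K + 2) ^ N with hGdef
  have hG : 1 ≤ G := one_le_pow₀ hG1
  have hε : 0 < 1 / (4 * G) := by positivity
  have hε1 : 1 / (4 * G) ≤ 1 := (div_le_one (by positivity)).2 (by linarith)
  refine ⟨1 / (4 * G), hε, fun F' hFF' => ?_⟩
  have hhalf : ∀ (j₀ : ℕ) (x : ℕ → E), (∀ j ≥ j₀, x (j + 1) = F' j (x j)) →
      ‖x j₀ - x₀‖ < δ → ‖x (j₀ + N) - x₀‖ ≤ 1 / 2 * ‖x j₀ - x₀‖ := by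
    intro j₀ x hx hxδ
    obtain ⟨y, hy0, hy⟩ := exists_trajectory_from F j₀ (x j₀)
    have h1 := norm_trajectory_sub_le_of_perturbed hF hx₀ hε.le hε1 hFF' hx hy hy0 N
    have h2 := hst j₀ y hy (hy0 ▸ hxδ) N
    have h3 : 1 / (4 * G) * (K + 2) ^ N = 1 / 4 := by
      rw [← hGdef]; field_simp
    rw [h3] at h1
    rw [hy0] at h2
    have h4 := mul_le_mul_of_nonneg_right hcq.le (norm_nonneg (x j₀ - x₀))
    have h5 := norm_add_le (x (j₀ + N) - y (j₀ + N)) (y (j₀ + N) - x₀)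
    rw [sub_add_sub_cancel] at h5
    linarith
  obtain ⟨p, hp0, hp1, hp⟩ := half_pow_div_le hN
  refine ⟨2 * G, by positivity, p, hp0, hp1, δ, hδ, fun j₀ x hx hxδ i => ?_⟩
  have hwin : ∀ m : ℕ, ‖x (j₀ + N * m) - x₀‖ ≤ (1 / 2) ^ m * ‖x j₀ - x₀‖ := by
    intro m
    induction m with
    | zero => simp
    | succ m ih =>
      -- Keeps the start of the next window inside the `δ`-ball, where the halving estimate is
      -- available.
      have hm1 : (1 / 2 : ℝ) ^ m ≤ 1 := pow_le_one₀ (by norm_num) (by norm_num)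
      have h1 := hhalf (j₀ + N * m) x (fun j hj => hx j (by omega))
        ((ih.trans (mul_le_of_le_one_left (norm_nonneg _) hm1)).trans_lt hxδ)
      rw [Nat.mul_succ, ← add_assoc, pow_succ']
      linarith
  have hgrow := norm_sub_le_pow_of_linear_growth (by positivity)
    (norm_sub_le_of_perturbed hF hx₀ hε1 hFF') (x := x) (j₀ := j₀ + N * (i / N))
    (fun j hj => hx j (by omega)) (i % N)
  rw [add_assoc, Nat.div_add_mod] at hgrow
  calc ‖x (j₀ + i) - x₀‖ ≤ (K + 2) ^ (i % N) * ‖x (j₀ + N * (i / N)) - x₀‖ := hgrow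
    _ ≤ G * ((2 * p ^ i) * ‖x j₀ - x₀‖) := by
        refine mul_le_mul (pow_le_pow_right₀ hG1 (Nat.mod_lt i hN).le) ((hwin _).trans ?_)
          (norm_nonneg _) (by positivity)
        exact mul_le_mul_of_nonneg_right (hp i) (norm_nonneg _)
    _ = 2 * G * p ^ i * ‖x j₀ - x₀‖ := by ring

end DiscreteRobustness

/-! ### Robustness of exponential stability in continuous time -/

section ContinuousRobustness

theorem norm_le_mul_of_lipschitzWith {E : Type*} [NormedAddCommGroup E] {g : ℝ → E → E} {x₀ : E}
    {K : NNReal} (hg : ∀ t, LipschitzWith K (g t)) (hx₀ : ∀ t, g t x₀ = 0)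
    (t : ℝ) (x : E) : ‖g t x‖ ≤ K * ‖x - x₀‖ := by
  simpa only [hx₀, dist_eq_norm, sub_zero] using (hg t).dist_le_mul x x₀

variable {E : Type*} [NormedAddCommGroup E] [NormedSpace ℝ E]

/-- Local exponential stability, uniform in the starting time, of the equilibrium `x₀` of
`ẋ = g t x`. -/
def IsExpStableContinuous (g : ℝ → E → E) (x₀ : E) : Prop :=
  ∃ c > 0, ∃ rate > 0, ∃ δ > 0, ∀ t₀ T : ℝ, 0 ≤ t₀ → ∀ x : ℝ → E,
    (∀ t ∈ Icc t₀ T, HasDerivWithinAt x (g t (x t)) (Icc t₀ T) t) → ‖x t₀ - x₀‖ < δ →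
    ∀ t ∈ Icc t₀ T, ‖x t - x₀‖ ≤ c * Real.exp (-rate * (t - t₀)) * ‖x t₀ - x₀‖

variable {g g' : ℝ → E → E} {x₀ : E} {K : NNReal}

theorem HasDerivWithinAt.of_notMem_closure {x : ℝ → E} {v : E} {s : Set ℝ} {t : ℝ}
    (h : t ∉ closure s) : HasDerivWithinAt x v s t :=
  hasDerivWithinAt_iff_hasFDerivWithinAt.2 (HasFDerivWithinAt.of_notMem_closure h)

/-- Concatenation of two solutions of an ordinary differential equation. -/
theorem exists_solution_Icc_concat {a b c : ℝ} (hab : a ≤ b) (hbc : b ≤ c) {α β : ℝ → E}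
    (hα : ∀ t ∈ Icc a b, HasDerivWithinAt α (g t (α t)) (Icc a b) t)
    (hβ : ∀ t ∈ Icc b c, HasDerivWithinAt β (g t (β t)) (Icc b c) t) (hαβ : β b = α b) :
    ∃ γ : ℝ → E, γ a = α a ∧ ∀ t ∈ Icc a c, HasDerivWithinAt γ (g t (γ t)) (Icc a c) t := by
  set γ : ℝ → E := fun t => if t ≤ b then α t else β t with hγ
  have hγα : ∀ t ≤ b, γ t = α t := fun t ht => if_pos ht
  have hγβ : ∀ t ≥ b, γ t = β t := by
    intro t ht
    rcases ht.lt_or_eq with h | rfl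
    · exact if_neg (not_le.2 h)
    · rw [hγα b le_rfl, hαβ]
  refine ⟨γ, hγα a hab, fun t ht => ?_⟩
  rw [← Icc_union_Icc_eq_Icc hab hbc]
  refine HasDerivWithinAt.union ?_ ?_
  · rcases le_or_gt t b with h | h
    · rw [hγα t h]
      exact (hα t ⟨ht.1, h⟩).congr (fun s hs => hγα s hs.2) (hγα t h)
    · refine HasDerivWithinAt.of_notMem_closure ?_
      rw [isClosed_Icc.closure_eq]
      exact fun hm => h.not_ge hm.2
  · rcases le_or_gt b t with h | h
    · rw [hγβ t h]
      exact (hβ t ⟨h, ht.2⟩).congr (fun s hs => hγβ s hs.1) (hγβ t h)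
    · refine HasDerivWithinAt.of_notMem_closure ?_
      rw [isClosed_Icc.closure_eq]
      exact fun hm => h.not_ge hm.1

/-- On the ball of radius `‖xa - x₀‖` about `xa` the speed is at most `2 * K * ‖xa - x₀‖`, so a
solution cannot leave it within time `1 / (2 * K)`. This length does not depend on `a` or `xa`,
which is why the steps can be chained to any interval. -/
theorem exists_solution_Icc_step [CompleteSpace E] (hK : 0 < K)
    (hg : ∀ t, LipschitzWith K (g t)) (hgc : ∀ x, Continuous fun t => g t x)
    (hx₀ : ∀ t, g t x₀ = 0) (a : ℝ) (xa : E) :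
    ∃ α : ℝ → E, α a = xa ∧ ∀ t ∈ Icc a (a + 1 / (2 * K)),
      HasDerivWithinAt α (g t (α t)) (Icc a (a + 1 / (2 * K))) t := by
  have hK' : (0 : ℝ) < K := hK
  have ha : a ∈ Icc a (a + 1 / (2 * (K : ℝ))) := ⟨le_rfl, by
    have : 0 < 1 / (2 * (K : ℝ)) := by positivity
    linarith⟩
  refine IsPicardLindelof.exists_eq_forall_mem_Icc_hasDerivWithinAt₀ (t₀ := ⟨a, ha⟩)
    (a := ‖xa - x₀‖₊) (L := 2 * K * ‖xa - x₀‖₊) (K := K) ⟨fun t _ => (hg t).lipschitzOnWith,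
      fun x _ => (hgc x).continuousOn, fun t _ x hx => ?_, ?_⟩
  · refine (norm_le_mul_of_lipschitzWith hg hx₀ t x).trans ?_
    have h1 := norm_add_le (x - xa) (xa - x₀)
    rw [sub_add_sub_cancel] at h1
    have h2 : ‖x - xa‖ ≤ ‖xa - x₀‖ := by simpa [dist_eq_norm] using hx
    push_cast
    nlinarith
  · push_cast
    rw [max_eq_left (by linarith [ha.2])]
    refine le_of_eq ?_
    field_simp
    ring

/-- Global existence for a globally Lipschitz equation. -/
theorem exists_solution_Icc [CompleteSpace E] (hK : 0 < K)
    (hg : ∀ t, LipschitzWith K (g t)) (hgc : ∀ x, Continuous fun t => g t x)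
    (hx₀ : ∀ t, g t x₀ = 0) (a b : ℝ) (xa : E) :
    ∃ α : ℝ → E, α a = xa ∧ ∀ t ∈ Icc a b, HasDerivWithinAt α (g t (α t)) (Icc a b) t := by
  have hh : 0 < 1 / (2 * (K : ℝ)) := by
    have hK' : (0 : ℝ) < K := hK
    positivity
  have hn : ∀ n : ℕ, ∃ α : ℝ → E, α a = xa ∧ ∀ t ∈ Icc a (a + n * (1 / (2 * K))),
      HasDerivWithinAt α (g t (α t)) (Icc a (a + n * (1 / (2 * K)))) t := by
    intro n
    induction n with
    | zero =>
      refine ⟨fun _ => xa, rfl, fun t _ => ?_⟩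
      simp only [Nat.cast_zero, zero_mul, add_zero, Icc_self]
      exact hasDerivWithinAt_iff_hasFDerivWithinAt.2
        (HasFDerivWithinAt.of_subsingleton subsingleton_singleton)
    | succ n ih =>
      obtain ⟨α, hαa, hα⟩ := ih
      obtain ⟨β, hβb, hβ⟩ := exists_solution_Icc_step hK hg hgc hx₀ (a + n * (1 / (2 * K)))
        (α (a + n * (1 / (2 * K))))
      obtain ⟨γ, hγa, hγ⟩ := exists_solution_Icc_concat
        (by linarith [mul_nonneg (Nat.cast_nonneg (α := ℝ) n) hh.le]) (by linarith) hα hβ hβb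
      refine ⟨γ, hγa.trans hαa, ?_⟩
      have he : a + ((n + 1 : ℕ) : ℝ) * (1 / (2 * K)) =
          a + n * (1 / (2 * K)) + 1 / (2 * K) := by push_cast; ring
      rwa [he]
  obtain ⟨n, hnb⟩ := exists_nat_gt ((b - a) / (1 / (2 * (K : ℝ))))
  obtain ⟨α, hαa, hα⟩ := hn n
  have hle : b ≤ a + n * (1 / (2 * K)) := by
    have := (div_lt_iff₀ hh).1 hnb
    linarith
  have hsub : Icc a b ⊆ Icc a (a + n * (1 / (2 * K))) := Icc_subset_Icc_right hle
  exact ⟨α, hαa, fun t ht => (hα t (hsub ht)).mono hsub⟩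

theorem HasDerivWithinAt.Ici_of_Icc {x : ℝ → E} {v : E} {a b t : ℝ} (ht : t ∈ Ico a b)
    (h : HasDerivWithinAt x v (Icc a b) t) : HasDerivWithinAt x v (Ici t) t :=
  h.mono_of_mem_nhdsWithin (Icc_mem_nhdsGE_of_mem ht)

theorem norm_sub_le_exp_of_linear_growth {G : ℝ} (hg : ∀ t x, ‖g t x‖ ≤ G * ‖x - x₀‖)
    {a b : ℝ} {x : ℝ → E} (hx : ∀ t ∈ Icc a b, HasDerivWithinAt x (g t (x t)) (Icc a b) t) :
    ∀ t ∈ Icc a b, ‖x t - x₀‖ ≤ ‖x a - x₀‖ * Real.exp (G * (t - a)) := by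
  have hx' : ∀ t ∈ Icc a b,
      HasDerivWithinAt (fun t => x t - x₀) (g t (x t)) (Icc a b) t := fun t ht =>
    (hx t ht).sub_const x₀
  intro t ht
  rw [← gronwallBound_ε0]
  exact norm_le_gronwallBound_of_norm_deriv_right_le
    (fun t ht => (hx' t ht).continuousWithinAt)
    (fun t ht => (hx' t (Ico_subset_Icc_self ht)).Ici_of_Icc ht) le_rfl
    (fun t _ => by rw [add_zero]; exact hg t (x t)) t ht

/-- Halving once per time `τ` is decay at rate `log 2 / τ`; the factor 2 absorbs the rounding down.
-/
theorem half_pow_floor_le (τ s : ℝ) :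
    (1 / 2 : ℝ) ^ ⌊s / τ⌋₊ ≤ 2 * Real.exp (-(Real.log 2 / τ) * s) := by
  have h1 : (1 / 2 : ℝ) ^ ⌊s / τ⌋₊ = 2 * Real.exp (-Real.log 2 * (⌊s / τ⌋₊ + 1)) := by
    rw [mul_add, Real.exp_add, mul_one, Real.exp_neg, Real.exp_log two_pos, mul_comm (-_),
      Real.exp_nat_mul, Real.exp_neg, Real.exp_log two_pos]
    ring
  rw [h1]
  have h2 : s / τ < ⌊s / τ⌋₊ + 1 := Nat.lt_floor_add_one _
  have h3 : -Real.log 2 * (⌊s / τ⌋₊ + 1) ≤ -(Real.log 2 / τ) * s := by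
    have h4 := mul_le_mul_of_nonneg_left h2.le (Real.log_nonneg one_le_two)
    have h5 : Real.log 2 / τ * s = Real.log 2 * (s / τ) := by ring
    linarith
  exact mul_le_mul_of_nonneg_left (Real.exp_le_exp.2 h3) two_pos.le

/-- Local exponential stability is robust under small perturbations vanishing linearly at the
equilibrium. -/
theorem IsExpStableContinuous.exists_robust [CompleteSpace E] (hK : 1 ≤ K)
    (hg : ∀ t, LipschitzWith K (g t)) (hgc : ∀ x, Continuous fun t => g t x)
    (hx₀ : ∀ t, g t x₀ = 0) (hst : IsExpStableContinuous g x₀) :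
    ∃ ε > 0, ∀ g' : ℝ → E → E, (∀ t x, ‖g' t x - g t x‖ ≤ ε * ‖x - x₀‖) →
      IsExpStableContinuous g' x₀ := by
  obtain ⟨c, hc, rate, hrate, δ, hδ, hst⟩ := hst
  have hK1 : (1 : ℝ) ≤ K := hK
  have hlim : Tendsto (fun τ : ℝ => c * Real.exp (-rate * τ)) atTop (𝓝 0) := by
    have h1 : Tendsto (fun τ : ℝ => -rate * τ) atTop atBot :=
      tendsto_id.const_mul_atTop_of_neg (neg_lt_zero.2 hrate)
    simpa using (Real.tendsto_exp_atBot.comp h1).const_mul c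
  obtain ⟨τ, hcτ, hτ⟩ := ((hlim.eventually (gt_mem_nhds (by norm_num : (0 : ℝ) < 1 / 4))).and
    (eventually_gt_atTop 0)).exists
  -- `G` bounds the growth of perturbed solutions over one window of length `τ`, and `D` the
  -- Gronwall amplification of the nominal equation. The choice `ε = 1 / (4 * (G * D))` cancels both
  -- and leaves 1/4.
  set G : ℝ := Real.exp ((K + 1) * τ) with hGdef
  set D : ℝ := Real.exp (K * τ) with hDdef
  have hG : 1 ≤ G := Real.one_le_exp (by positivity)
  have hD : 1 ≤ D := Real.one_le_exp (by positivity)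
  have hGD : 1 ≤ G * D := one_le_mul_of_one_le_of_one_le hG hD
  have hε : 0 < 1 / (4 * (G * D)) := by positivity
  have hε1 : 1 / (4 * (G * D)) ≤ 1 := (div_le_one (by positivity)).2 (by linarith)
  set ε : ℝ := 1 / (4 * (G * D)) with hεdef
  refine ⟨ε, hε, fun g' hgg' => ?_⟩
  have hg' : ∀ t x, ‖g' t x‖ ≤ (K + 1) * ‖x - x₀‖ := by
    intro t x
    have h1 := norm_add_le (g' t x - g t x) (g t x)
    rw [sub_add_cancel] at h1
    have h2 := norm_le_mul_of_lipschitzWith hg hx₀ t x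
    have h3 := mul_le_mul_of_nonneg_right hε1 (norm_nonneg (x - x₀))
    linarith [hgg' t x]
  have hgrow : ∀ (a b : ℝ) (x : ℝ → E),
      (∀ t ∈ Icc a b, HasDerivWithinAt x (g' t (x t)) (Icc a b) t) →
      ∀ t ∈ Icc a b, t ≤ a + τ → ‖x t - x₀‖ ≤ G * ‖x a - x₀‖ := by
    intro a b x hx t ht htτ
    refine (norm_sub_le_exp_of_linear_growth hg' hx t ht).trans ?_
    rw [mul_comm]
    refine mul_le_mul_of_nonneg_right (Real.exp_le_exp.2 ?_) (norm_nonneg _)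
    exact mul_le_mul_of_nonneg_left (by linarith) (by linarith)
  have hhalf : ∀ (a : ℝ) (x : ℝ → E), 0 ≤ a →
      (∀ t ∈ Icc a (a + τ), HasDerivWithinAt x (g' t (x t)) (Icc a (a + τ)) t) →
      ‖x a - x₀‖ < δ → ‖x (a + τ) - x₀‖ ≤ 1 / 2 * ‖x a - x₀‖ := by
    intro a x ha hx hxδ
    obtain ⟨y, hya, hy⟩ := exists_solution_Icc (zero_lt_one.trans_le hK) hg hgc hx₀ a (a + τ) (x a)
    have hmem : a + τ ∈ Icc a (a + τ) := ⟨by linarith, le_rfl⟩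
    have h1 := hst a (a + τ) ha y hy (hya ▸ hxδ) _ hmem
    rw [hya, add_sub_cancel_left] at h1
    -- The perturbed solution is regarded as an approximate solution of the nominal equation; its
    -- defect is bounded through the growth estimate on the window.
    have h2 := dist_le_of_approx_trajectories_ODE (K := K) (εf := ε * (G * ‖x a - x₀‖)) (εg := 0)
      (δ := 0) hg (fun t ht => (hx t ht).continuousWithinAt)
      (fun t ht => (hx t (Ico_subset_Icc_self ht)).Ici_of_Icc ht)
      (fun t ht => by
        rw [dist_eq_norm]
        exact (hgg' t _).trans (mul_le_mul_of_nonneg_left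
          (hgrow a (a + τ) x hx t (Ico_subset_Icc_self ht) ht.2.le) hε.le))
      (fun t ht => (hy t ht).continuousWithinAt)
      (fun t ht => (hy t (Ico_subset_Icc_self ht)).Ici_of_Icc ht)
      (fun t _ => (dist_self _).le) (by rw [hya, dist_self]) _ hmem
    rw [add_sub_cancel_left, dist_eq_norm, add_zero,
      gronwallBound_of_K_ne_0 (zero_lt_one.trans_le hK1).ne'] at h2
    beta_reduce at h2
    rw [zero_mul, zero_add] at h2
    have hr := norm_nonneg (x a - x₀)
    -- Here `1 ≤ K` allows the division by `K` in the Gronwall bound to be dropped.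
    have h3 : ε * (G * ‖x a - x₀‖) / K * (Real.exp (K * τ) - 1) ≤ 1 / 4 * ‖x a - x₀‖ := by
      calc ε * (G * ‖x a - x₀‖) / K * (Real.exp (K * τ) - 1)
          ≤ ε * (G * ‖x a - x₀‖) * D :=
            mul_le_mul (div_le_self (by positivity) hK1) (by linarith) (by linarith)
              (by positivity)
        _ = 1 / 4 * ‖x a - x₀‖ := by rw [hεdef]; field_simp
    have h4 := mul_le_mul_of_nonneg_right hcτ.le hr
    have h5 := norm_add_le (x (a + τ) - y (a + τ)) (y (a + τ) - x₀)
    rw [sub_add_sub_cancel] at h5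
    linarith
  refine ⟨2 * G, by positivity, Real.log 2 / τ, div_pos (Real.log_pos one_lt_two) hτ, δ, hδ,
    fun t₀ T ht₀ x hx hxδ t ht => ?_⟩
  have hwin : ∀ m : ℕ, t₀ + m * τ ≤ T →
      ‖x (t₀ + m * τ) - x₀‖ ≤ (1 / 2) ^ m * ‖x t₀ - x₀‖ := by
    intro m hm
    induction m with
    | zero => simp
    | succ m ih =>
      have he : t₀ + ((m + 1 : ℕ) : ℝ) * τ = t₀ + m * τ + τ := by push_cast; ring
      rw [he] at hm ⊢
      have hm0 : 0 ≤ (m : ℝ) * τ := by positivity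
      have ih := ih (by linarith)
      have hm1 : (1 / 2 : ℝ) ^ m ≤ 1 := pow_le_one₀ (by norm_num) (by norm_num)
      have hsub : Icc (t₀ + m * τ) (t₀ + m * τ + τ) ⊆ Icc t₀ T :=
        Icc_subset_Icc (by linarith) hm
      have h1 := hhalf (t₀ + m * τ) x (by linarith) (fun t ht => (hx t (hsub ht)).mono hsub)
        ((ih.trans (mul_le_of_le_one_left (norm_nonneg _) hm1)).trans_lt hxδ)
      rw [pow_succ']
      linarith
  -- The number of complete windows before `t`; the remaining time is shorter than `τ` and costs at
  -- most the factor `G`.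
  set m := ⌊(t - t₀) / τ⌋₊
  have ht0 : 0 ≤ t - t₀ := sub_nonneg.2 ht.1
  have hm1 : m * τ ≤ t - t₀ := (le_div_iff₀ hτ).1 (Nat.floor_le (by positivity))
  have hm2 : t - t₀ < (m + 1) * τ := (div_lt_iff₀ hτ).1 (Nat.lt_floor_add_one _)
  have hm0 : 0 ≤ (m : ℝ) * τ := by positivity
  have hsub : Icc (t₀ + m * τ) T ⊆ Icc t₀ T := Icc_subset_Icc_left (by linarith)
  have h1 := hgrow (t₀ + m * τ) T x (fun t ht => (hx t (hsub ht)).mono hsub) t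
    ⟨by linarith, ht.2⟩ (by linarith)
  have h2 := hwin m (by linarith [ht.2])
  have h3 := mul_le_mul_of_nonneg_right (half_pow_floor_le τ (t - t₀))
    (norm_nonneg (x t₀ - x₀))
  calc ‖x t - x₀‖ ≤ G * ‖x (t₀ + m * τ) - x₀‖ := h1
    _ ≤ G * (2 * Real.exp (-(Real.log 2 / τ) * (t - t₀)) * ‖x t₀ - x₀‖) :=
        mul_le_mul_of_nonneg_left (h2.trans h3) (by positivity)
    _ = 2 * G * Real.exp (-(Real.log 2 / τ) * (t - t₀)) * ‖x t₀ - x₀‖ := by ring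

end ContinuousRobustness

/-! ### Openness of the set of stabilizing matrices -/

section StabilizingMatrices

variable {n : ℕ} {x₀ : EuclideanSpace ℝ (Fin n)} {L : NNReal}

/-- Passing from a matrix to its operator is linear on a finite-dimensional space, hence continuous
for the operator norm. -/
theorem eventually_norm_toEuclideanLin_sub_le (B : Matrix (Fin n) (Fin n) ℝ) {ε : ℝ} (hε : 0 < ε) :
    ∀ᶠ B' in 𝓝 B, ∀ v : EuclideanSpace ℝ (Fin n),
      ‖Matrix.toEuclideanLin B' v - Matrix.toEuclideanLin B v‖ ≤ ε * ‖v‖ := by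
  let l : Matrix (Fin n) (Fin n) ℝ →ₗ[ℝ]
      (EuclideanSpace ℝ (Fin n) →L[ℝ] EuclideanSpace ℝ (Fin n)) :=
    LinearMap.toContinuousLinearMap.toLinearMap ∘ₗ Matrix.toEuclideanLin.toLinearMap
  have hc : Continuous l := l.continuous_of_finiteDimensional
  filter_upwards [Metric.tendsto_nhds.1 (hc.tendsto B) ε hε] with B' hB' v
  rw [dist_eq_norm] at hB'
  exact (ContinuousLinearMap.le_opNorm (LinearMap.toContinuousLinearMap (Matrix.toEuclideanLin B') -
    LinearMap.toContinuousLinearMap (Matrix.toEuclideanLin B)) v).trans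
      (mul_le_mul_of_nonneg_right hB'.le (norm_nonneg v))

/-- A common Lipschitz constant of the closed loops under the feedback matrix `B`. -/
theorem exists_lipschitzWith_closedLoop (L : NNReal) (x₀ : EuclideanSpace ℝ (Fin n))
    (B : Matrix (Fin n) (Fin n) ℝ) :
    ∃ K : NNReal, 1 ≤ K ∧ ∀ f : EuclideanSpace ℝ (Fin n) → EuclideanSpace ℝ (Fin n),
      LipschitzWith L f → LipschitzWith K fun x => f x + Matrix.toEuclideanLin B (x - x₀) := by
  set A := LinearMap.toContinuousLinearMap (Matrix.toEuclideanLin B)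
  refine ⟨L + ‖A‖₊ * (1 + 0) + 1, le_add_self, fun f hf => ?_⟩
  refine LipschitzWith.weaken (hf.add (A.lipschitz.comp
    (LipschitzWith.id.sub (LipschitzWith.const x₀)))) le_self_add

theorem isOpen_isStabilizingContinuous {f : EuclideanSpace ℝ (Fin n) → ℝ → EuclideanSpace ℝ (Fin n)}
    (hfc : ∀ x, Continuous (f x)) (hf : ∀ t, LipschitzWith L fun x => f x t)
    (hx₀ : ∀ t, f x₀ t = 0) : IsOpen {B | IsStabilizingContinuous f x₀ B} := by
  refine isOpen_iff_mem_nhds.2 fun B hB => ?_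
  obtain ⟨K, hK, hlip⟩ := exists_lipschitzWith_closedLoop L x₀ B
  -- Stabilization by `B` unfolds to exponential stability of this closed loop. Changing `B` to `B'`
  -- perturbs it by a term linear in `x - x₀`, exactly the kind of perturbation that robustness
  -- admits.
  obtain ⟨ε, hε, hrob⟩ := IsExpStableContinuous.exists_robust
    (g := fun t x => f x t + Matrix.toEuclideanLin B (x - x₀)) hK (fun t => hlip _ (hf t))
    (fun x => (hfc x).add continuous_const) (fun t => by simp [hx₀]) hB
  filter_upwards [eventually_norm_toEuclideanLin_sub_le B hε] with B' hB'
  refine hrob (fun t x => f x t + Matrix.toEuclideanLin B' (x - x₀)) fun t x => ?_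
  rw [add_sub_add_left_eq_sub]
  exact hB' _

theorem isOpen_isStabilizingDiscrete {f : EuclideanSpace ℝ (Fin n) → ℕ → EuclideanSpace ℝ (Fin n)}
    (hf : ∀ j, LipschitzWith L fun x => f x j) (hx₀ : ∀ j, f x₀ j = x₀) :
    IsOpen {B | IsStabilizingDiscrete f x₀ B} := by
  refine isOpen_iff_mem_nhds.2 fun B hB => ?_
  obtain ⟨K, -, hlip⟩ := exists_lipschitzWith_closedLoop L x₀ B
  obtain ⟨ε, hε, hrob⟩ := IsExpStableDiscrete.exists_robust
    (F := fun j x => f x j + Matrix.toEuclideanLin B (x - x₀)) (fun j => hlip _ (hf j))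
    (fun j => by simp [hx₀]) hB
  filter_upwards [eventually_norm_toEuclideanLin_sub_le B hε] with B' hB'
  refine hrob (fun j x => f x j + Matrix.toEuclideanLin B' (x - x₀)) fun j x => ?_
  rw [add_sub_add_left_eq_sub]
  exact hB' _

end StabilizingMatrices


theorem mainTheorem2 :
    -- the total reward as objective, with piecewise control laws
    (∀ (X : Type*) [TopologicalSpace X] [TopologicalSpace.MetrizableSpace X]
        [SecondCountableTopology X] [MeasurableSpace X] [BorelSpace X] (d k M : ℕ)
        (S : ControlProblem X d k M) (κ : ControlModel d k) (Θ : Set (Fin M → κ.Param)),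
        S.IsRegular → (optimalSet (S.totalReward κ) Θ).Nonempty →
        (∀ θ : ℕ → Fin M → κ.Param, IsDenseSearch Θ θ →
          ConvergesToOptimal (S.totalReward κ) Θ (incumbent (S.totalReward κ) θ)) ∧
        (∀ (Ω : Type*) [m : MeasurableSpace Ω] (μ : Measure Ω) [IsProbabilityMeasure μ]
          (ℱ : Filtration ℕ m) (θ : ℕ → Ω → Fin M → κ.Param), IsExploringSearch μ ℱ Θ θ →
          ∀ᵐ ω ∂μ, ConvergesToOptimal (S.totalReward κ) Θ
            (incumbent (S.totalReward κ) fun e => θ e ω))) ∧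
    -- stabilization as the goal of the task, in continuous or discrete time
    (∀ (n : ℕ) (L : NNReal) (x₀ : EuclideanSpace ℝ (Fin n))
        (stab : Set (Matrix (Fin n) (Fin n) ℝ)),
        ((∃ f : EuclideanSpace ℝ (Fin n) → ℝ → EuclideanSpace ℝ (Fin n),
            (∀ x, Continuous (f x)) ∧ (∀ t, LipschitzWith L fun x => f x t) ∧
            (∀ t, f x₀ t = 0) ∧ stab = {B | IsStabilizingContinuous f x₀ B}) ∨
          (∃ f : EuclideanSpace ℝ (Fin n) → ℕ → EuclideanSpace ℝ (Fin n),
            (∀ j, LipschitzWith L fun x => f x j) ∧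
            (∀ j, f x₀ j = x₀) ∧ stab = {B | IsStabilizingDiscrete f x₀ B})) →
        ∀ (Θ : Set (Matrix (Fin n) (Fin n) ℝ)) (R : Matrix (Fin n) (Fin n) ℝ → ℝ),
        optimalSet R Θ = Θ ∩ stab → (Θ ∩ stab).Nonempty →
        (∀ θ : ℕ → Matrix (Fin n) (Fin n) ℝ, IsDenseSearch Θ θ →
          ∀ᶠ e in atTop, incumbent R θ e ∈ optimalSet R Θ) ∧
        (∀ (Ω : Type*) [m : MeasurableSpace Ω] (μ : Measure Ω) [IsProbabilityMeasure μ]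
          (ℱ : Filtration ℕ m) (θ : ℕ → Ω → Matrix (Fin n) (Fin n) ℝ),
          IsExploringSearch μ ℱ Θ θ →
          ∀ᵐ ω ∂μ, ∀ᶠ e in atTop, incumbent R (fun e' => θ e' ω) e ∈ optimalSet R Θ)) := by
  refine ⟨?_, ?_⟩
  · intro X _ _ _ _ _ d k M S κ Θ hS hne
    have hJ := hS.continuous_totalReward κ
    exact ⟨fun θ h => h.convergesToOptimal hJ hne,
      fun Ω m μ _ ℱ θ h => h.convergesToOptimal hJ hne⟩
  · intro n L x₀ stab hstab Θ R heq hne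
    -- Openness is all that is needed of the dynamics; the reward `R` enters only through its
    -- maximizers.
    have hopen : IsOpen stab := by
      rcases hstab with ⟨f, hfc, hf, hx₀, rfl⟩ | ⟨f, hf, hx₀, rfl⟩
      · exact isOpen_isStabilizingContinuous hfc hf hx₀
      · exact isOpen_isStabilizingDiscrete hf hx₀
    exact ⟨fun θ h => h.eventually_mem_optimalSet hopen heq hne,
      fun Ω m μ _ ℱ θ h => h.eventually_mem_optimalSet hopen heq hne⟩
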